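/- Let $S^1=\{z\in\mathbb{C}:|z|=1\}$, let $\sigma_1$ be the normalized uniform (arc length) probability measure on $S^1$, and for $\lambda>0$ put $$I_\lambda(\sigma_1)=\int_{S^1}\int_{S^1}|x-y|^\lambda\,d\sigma_1(x)\,d\sigma_1(y).$$ Let $0<\lambda<2$ and let $(a_n)_{n=0}^\infty\subset S^1$ be a greedy $\lambda$-energy sequence, that is, with $U_n(x)=\sum_{k=0}^{n-1}|x-a_k|^\lambda$, $$U_n(a_n)=\max_{x\in S^1}U_n(x)\qquad\text{for all } n\ge 1.$$ Then the sequence $\bigl(U_N(a_N)-N\,I_\lambda(\sigma_1)\bigr)_{N=1}^\infty$ is bounded and divergent (it has no limit), and for every $N\ge 1$, $$0<U_N(a_N)-N\,I_\lambda(\sigma_1)<I_\lambda(\sigma_1).$$ These inequalities are sharp, since $$\liminf_{N\to\infty}\bigl(U_N(a_N)-N\,I_\lambda(\sigma_1)\bigr)=0,\qquad \limsup_{N\to\infty}\bigl(U_N(a_N)-N\,I_\lambda(\sigma_1)\bigr)=I_\lambda(\sigma_1);$$ moreover, $U_N(a_N)-N\,I_\lambda(\sigma_1)$ tends to $0$ along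 $N=2^n$ and to $I_\lambda(\sigma_1)$ along $N=2^n-1$, as $n\to\infty$. -/

import Mathlib

open Filter Topology MeasureTheory

noncomputable section

namespace GreedyCircle

/-- The discrete potential `U_n(x) = ∑_{k=0}^{n-1} |x - a_k|^lam` of the first `n` points of the
sequence `a` on the unit circle `S¹ ⊂ ℂ`. -/
def potential (lam : ℝ) (a : ℕ → Circle) (n : ℕ) (x : Circle) : ℝ :=
  ∑ k ∈ Finset.range n, ‖(x : ℂ) - (a k : ℂ)‖ ^ lam

/-- A greedy `lam`-energy sequence on `S¹`: for each `n ≥ 1`, the point `a_n` is a point where the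
potential `U_n` of the previous points attains its maximum over `S¹`. -/
def IsGreedy (lam : ℝ) (a : ℕ → Circle) : Prop :=
  ∀ n : ℕ, 1 ≤ n → ∀ x : Circle, potential lam a n x ≤ potential lam a n (a n)

/-- The unit circle carries its Borel `σ`-algebra. -/
instance instMeasurableSpaceCircle : MeasurableSpace Circle := borel Circle

instance instBorelSpaceCircle : BorelSpace Circle := ⟨rfl⟩

/-- The normalized uniform (arc length) measure `σ₁` on `S¹`: the image of the uniform probability
measure `dθ / (2π)` on `(0, 2π]` under `θ ↦ exp (i θ)`. -/
def sigmaOne : Measure Circle :=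
  Measure.map Circle.exp
    ((ENNReal.ofReal (2 * Real.pi))⁻¹ • (volume.restrict (Set.Ioc 0 (2 * Real.pi))))

/-- The `lam`-energy `I_lam(μ) = ∬ |x - y|^lam dμ(x) dμ(y)` of a measure `μ` on `S¹`. -/
def energy (lam : ℝ) (μ : Measure Circle) : ℝ :=
  ∫ y : Circle, ∫ x : Circle, ‖(x : ℂ) - (y : ℂ)‖ ^ lam ∂μ ∂μ

/-- The second-order term `U_N(a_N) - N I_lam(σ₁)`. -/
def secondOrder (lam : ℝ) (a : ℕ → Circle) (N : ℕ) : ℝ :=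
  potential lam a N (a N) - (N : ℝ) * energy lam sigmaOne

end GreedyCircle

end

/-! Put λ = 2s. The integral representation of `t ↦ t ^ s`, applied to the squared distance, writes
`‖x - c‖ ^ (2 * s)` as a constant plus a positive mixture over radii r of `1 - poisson r x c`
(`rpowIntegrand_eq_weight`). Poisson kernels average well: over N equally spaced sources, radius r
becomes r^N and the points become their N-th powers. Hence the potential of such a configuration is
largest exactly at the midpoints (`IsPoissonRegular.potential_eq_iff`), with excess `midpointExcess
s N` over the mean.

After 2^n greedy points the next 2^n are therefore midpoints, and they form a greedy sequence of
their own (`greedy_shift`, `greedy_structure`). So the excess at m is the sum of `midpointExcess s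
(2 ^ i)` over the binary digits 1 of m (`excess_add`). Since `midpointExcess s N = nodeDeficit s N -
nodeDeficit s (2 * N)`, these sums telescope. All digits equal to 1 gives the supremum `nodeDeficit
s 1`, which is the energy (`energy_eq_nodeDeficit`); a single high digit gives almost 0, because
`nodeDeficit s N` tends to 0. -/

namespace GreedyCircle

/-! ### Extreme values and doubling of the Poisson kernel. -/

/-- The Poisson kernel of the unit disc at the point `R c`, for `c` on the unit circle. -/
noncomputable def poisson (R : ℝ) (x c : ℂ) : ℝ := (1 - R ^ 2) / Complex.normSq (x - R * c)

lemma normSq_sub_real_mul (R : ℝ) {x c : ℂ} (hx : Complex.normSq x = 1)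
    (hc : Complex.normSq c = 1) :
    Complex.normSq (x - R * c) = 1 + R ^ 2 - 2 * R * (x.re * c.re + x.im * c.im) := by
  rw [Complex.normSq_apply] at *
  simp only [Complex.sub_re, Complex.sub_im, Complex.mul_re, Complex.mul_im, Complex.ofReal_re,
    Complex.ofReal_im]
  linear_combination hx + R ^ 2 * hc

lemma normSq_add_of_unit {x c : ℂ} (hx : Complex.normSq x = 1) (hc : Complex.normSq c = 1) :
    Complex.normSq (x + c) = 2 + 2 * (x.re * c.re + x.im * c.im) := by
  rw [Complex.normSq_add, hx, hc]
  simp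
  ring

lemma normSq_sub_of_unit {x c : ℂ} (hx : Complex.normSq x = 1) (hc : Complex.normSq c = 1) :
    Complex.normSq (x - c) = 2 - 2 * (x.re * c.re + x.im * c.im) := by
  rw [Complex.normSq_sub, hx, hc]
  simp
  ring

lemma normSq_sub_real_mul_pos {R : ℝ} (h0 : 0 < R) (h1 : R < 1) {x c : ℂ}
    (hx : Complex.normSq x = 1) (hc : Complex.normSq c = 1) :
    0 < Complex.normSq (x - R * c) := by
  have h := Complex.normSq_nonneg (x - c)
  rw [normSq_sub_of_unit hx hc] at h
  rw [normSq_sub_real_mul R hx hc]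
  nlinarith [sq_pos_of_pos (sub_pos.2 h1)]

/-- On the circle the Poisson kernel decreases with the distance from x to c, so its extremes are (1
+ R) / (1 - R) at x = c and (1 - R) / (1 + R) at x = -c. -/
lemma poisson_le {R : ℝ} (h0 : 0 < R) (h1 : R < 1) {x c : ℂ}
    (hx : Complex.normSq x = 1) (hc : Complex.normSq c = 1) :
    -(2 * R / (1 - R)) ≤ 1 - poisson R x c := by
  have h := Complex.normSq_nonneg (x - c)
  rw [normSq_sub_of_unit hx hc] at h
  have hp := normSq_sub_real_mul_pos h0 h1 hx hc
  have h1' : 0 < 1 - R := sub_pos.2 h1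
  have : poisson R x c ≤ (1 + R) / (1 - R) := by
    rw [poisson, div_le_div_iff₀ hp h1', normSq_sub_real_mul R hx hc]
    nlinarith [mul_nonneg (mul_nonneg h0.le h) (by linarith : 0 ≤ 1 + R)]
  have e : (1 + R) / (1 - R) = 1 + 2 * R / (1 - R) := by field_simp; ring
  linarith

lemma one_sub_poisson_le {R : ℝ} (h0 : 0 < R) (h1 : R < 1) {x c : ℂ}
    (hx : Complex.normSq x = 1) (hc : Complex.normSq c = 1) :
    1 - poisson R x c ≤ 2 * R / (1 + R) := by
  have h := Complex.normSq_nonneg (x + c)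
  rw [normSq_add_of_unit hx hc] at h
  have hp := normSq_sub_real_mul_pos h0 h1 hx hc
  have h1' : 0 < 1 + R := by linarith
  have : (1 - R) / (1 + R) ≤ poisson R x c := by
    rw [poisson, div_le_div_iff₀ h1' hp, normSq_sub_real_mul R hx hc]
    nlinarith [mul_nonneg (mul_nonneg h0.le h) (by linarith : 0 ≤ 1 - R)]
  have e : (1 - R) / (1 + R) = 1 - 2 * R / (1 + R) := by field_simp; ring
  linarith

lemma one_sub_poisson_lt {R : ℝ} (h0 : 0 < R) (h1 : R < 1) {x c : ℂ}
    (hx : Complex.normSq x = 1) (hc : Complex.normSq c = 1) (hne : x ≠ -c) :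
    1 - poisson R x c < 2 * R / (1 + R) := by
  have h : 0 < Complex.normSq (x + c) :=
    Complex.normSq_pos.2 fun h => hne (eq_neg_of_add_eq_zero_left h)
  rw [normSq_add_of_unit hx hc] at h
  have hp := normSq_sub_real_mul_pos h0 h1 hx hc
  have h1' : 0 < 1 + R := by linarith
  have : (1 - R) / (1 + R) < poisson R x c := by
    rw [poisson, div_lt_div_iff₀ h1' hp, normSq_sub_real_mul R hx hc]
    nlinarith [mul_pos (mul_pos h0 h) (by linarith : 0 < 1 - R)]
  have e : (1 - R) / (1 + R) = 1 - 2 * R / (1 + R) := by field_simp; ring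
  linarith

lemma one_sub_poisson_neg {R : ℝ} (h0 : 0 < R) {c : ℂ} (hc : Complex.normSq c = 1) :
    1 - poisson R (-c) c = 2 * R / (1 + R) := by
  have e : Complex.normSq (-c - R * c) = (1 + R) ^ 2 := by
    have : -c - R * c = ((-(1 + R) : ℝ) : ℂ) * c := by push_cast; ring
    rw [this, Complex.normSq_mul, hc, Complex.normSq_ofReal]; ring
  have : (1 + R) ≠ 0 := by positivity
  rw [poisson, e]
  field_simp
  ring

/-- Averaging the Poisson kernel over two antipodal sources squares all its arguments. -/
lemma poisson_add_poisson_neg {R : ℝ} (h0 : 0 < R) (h1 : R < 1) {x c : ℂ}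
    (hx : Complex.normSq x = 1) (hc : Complex.normSq c = 1) :
    poisson R x c + poisson R x (-c) = 2 * poisson (R ^ 2) (x ^ 2) (c ^ 2) := by
  have hc' : Complex.normSq (-c) = 1 := by rwa [Complex.normSq_neg]
  have p1 := normSq_sub_real_mul_pos h0 h1 hx hc
  have p2 := normSq_sub_real_mul_pos h0 h1 hx hc'
  have e : Complex.normSq (x ^ 2 - ((R ^ 2 : ℝ) : ℂ) * c ^ 2) =
      Complex.normSq (x - R * c) * Complex.normSq (x - R * -c) := by
    rw [← Complex.normSq_mul]; congr 1; push_cast; ring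
  have s : Complex.normSq (x - R * c) + Complex.normSq (x - R * -c) = 2 * (1 + R ^ 2) := by
    rw [normSq_sub_real_mul R hx hc, normSq_sub_real_mul R hx hc']
    simp only [Complex.neg_re, Complex.neg_im]
    ring
  rw [poisson, poisson, poisson, e, div_add_div _ _ p1.ne' p2.ne', ← mul_div_assoc]
  congr 1
  linear_combination (1 - R ^ 2) * s

/-! ### Powers of the distance as mixtures of Poisson kernels. -/

/-- The root in `(0, 1)` of `(1 - r) ^ 2 = u r`, for `u > 0`. -/
noncomputable def radius (u : ℝ) : ℝ := (u + 2 - √(u ^ 2 + 4 * u)) / 2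

lemma radius_spec {u : ℝ} (hu : 0 < u) :
    0 < radius u ∧ radius u < 1 ∧ (1 - radius u) ^ 2 = u * radius u := by
  have h := Real.sq_sqrt (by positivity : 0 ≤ u ^ 2 + 4 * u)
  have hp := Real.sqrt_pos.2 (by positivity : 0 < u ^ 2 + 4 * u)
  set q := √(u ^ 2 + 4 * u) with hq
  have e : radius u = (u + 2 - q) / 2 := rfl
  refine ⟨?_, ?_, ?_⟩
  · rw [e]; nlinarith
  · rw [e]; nlinarith
  · rw [e]; linear_combination h / 4

lemma continuous_radius : Continuous radius := by
  unfold radius; fun_prop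

/-- The density, against `du`, of the mixture of Poisson kernels representing `|x - y| ^ (2 s)`. -/
noncomputable def weight (s u : ℝ) : ℝ := u ^ s * (radius u / (1 - radius u ^ 2))

lemma weight_pos (s : ℝ) {u : ℝ} (hu : 0 < u) : 0 < weight s u := by
  obtain ⟨h0, h1, -⟩ := radius_spec hu
  have : 0 < 1 - radius u ^ 2 := by nlinarith
  unfold weight; positivity

lemma continuousOn_weight (s : ℝ) : ContinuousOn (weight s) (Set.Ioi 0) := by
  unfold weight
  refine ContinuousOn.mul (.rpow_const continuousOn_id fun t ht => .inl (ne_of_gt ht)) ?_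
  refine ContinuousOn.div continuous_radius.continuousOn
    (by have := continuous_radius; fun_prop) fun u hu => ?_
  obtain ⟨h0, h1, -⟩ := radius_spec hu
  nlinarith

/-- The normalizing constant of the integral representation of `x ↦ x ^ s`. -/
noncomputable def normConst (s : ℝ) : ℝ := (∫ t in Set.Ioi 0, Real.rpowIntegrand₀₁ s t 1)⁻¹

/-- The equation (1 - r)² = u r is what makes |x - r c|² = r (u + |x - c|²), so 1 / (u + |x - c|²)
is a multiple of the Poisson kernel. The first summand does not depend on the points and carries the
mean. -/
lemma rpowIntegrand_eq_weight (s : ℝ) {u : ℝ} (hu : 0 < u) {x c : ℂ}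
    (hx : Complex.normSq x = 1) (hc : Complex.normSq c = 1) :
    Real.rpowIntegrand₀₁ s u (Complex.normSq (x - c)) =
      weight s u * (2 * radius u / (1 - radius u)) +
        weight s u * (1 - poisson (radius u) x c) := by
  obtain ⟨h0, h1, h2⟩ := radius_spec hu
  have hp := normSq_sub_real_mul_pos h0 h1 hx hc
  have hn := Complex.normSq_nonneg (x - c)
  have e : Complex.normSq (x - (radius u : ℂ) * c)
      = radius u * (u + Complex.normSq (x - c)) := by
    rw [normSq_sub_of_unit hx hc, normSq_sub_real_mul _ hx hc]
    linear_combination h2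
  rw [poisson, e, Real.rpowIntegrand₀₁, weight]
  generalize radius u = r at *
  generalize Complex.normSq (x - c) = d at *
  have a1 : 1 - r ≠ 0 := by linarith
  have a2 : 1 - r ^ 2 ≠ 0 := by nlinarith
  have a3 : u + d ≠ 0 := by positivity
  have i1 : u⁻¹ = r / (1 - r) ^ 2 := by rw [h2]; field_simp
  rw [i1]
  have a4 : 1 - r ^ 2 = (1 - r) * (1 + r) := by ring
  have a5 : 1 + r ≠ 0 := by positivity
  rw [a4]
  field_simp
  ring

/-! ### Node deficits and midpoint excesses. -/

/-- The integrand of `nodeDeficit`. -/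
noncomputable def nodeIntegrand (s : ℝ) (N : ℕ) (u : ℝ) : ℝ :=
  weight s u * (N * (2 * radius u ^ N / (1 - radius u ^ N)))

/-- The integrand of `midpointExcess`. -/
noncomputable def midpointIntegrand (s : ℝ) (N : ℕ) (u : ℝ) : ℝ :=
  weight s u * (N * (2 * radius u ^ N / (1 + radius u ^ N)))

/-- The smallest term of 1 + r + ⋯ + r^(N-1) = (1 - r^N) / (1 - r) is r^(N-1). This bound, uniform
in N, provides the integrable dominating function. -/
lemma nat_mul_pow_div_le {r : ℝ} (h0 : 0 < r) (h1 : r < 1) {N : ℕ} (hN : 1 ≤ N) :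
    N * (2 * r ^ N / (1 - r ^ N)) ≤ 2 * r / (1 - r) := by
  have hN1 : r ^ N < 1 := pow_lt_one₀ h0.le h1 (by omega)
  have hgeom : (N : ℝ) * r ^ (N - 1) ≤ ∑ k ∈ Finset.range N, r ^ k := by
    have := Finset.card_nsmul_le_sum (Finset.range N) (fun k => r ^ k) (r ^ (N - 1)) fun k hk =>
      pow_le_pow_of_le_one h0.le h1.le (by have := Finset.mem_range.1 hk; omega)
    simpa using this
  have e : r ^ N = r * r ^ (N - 1) := by rw [← pow_succ']; congr 1; omega
  have g := geom_sum_mul_neg r N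
  rw [← mul_div_assoc, div_le_div_iff₀ (by linarith) (by linarith), ← g]
  have := mul_le_mul_of_nonneg_right hgeom (by nlinarith : 0 ≤ 2 * r * (1 - r))
  rw [e]
  linarith

lemma continuousOn_nodeIntegrand (s : ℝ) {N : ℕ} (hN : 1 ≤ N) :
    ContinuousOn (nodeIntegrand s N) (Set.Ioi 0) := by
  unfold nodeIntegrand
  have := continuous_radius
  refine (continuousOn_weight s).mul (continuousOn_const.mul (ContinuousOn.div (by fun_prop)
    (by fun_prop) fun u hu => ?_))
  obtain ⟨h0, h1, -⟩ := radius_spec hu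
  have := pow_lt_one₀ h0.le h1 (by omega : N ≠ 0)
  linarith

lemma nodeIntegrand_pos (s : ℝ) {N : ℕ} (hN : 1 ≤ N) {u : ℝ} (hu : 0 < u) :
    0 < nodeIntegrand s N u := by
  obtain ⟨h0, h1, -⟩ := radius_spec hu
  have h2 := weight_pos s hu
  have h3 := pow_lt_one₀ h0.le h1 (by omega : N ≠ 0)
  have h4 : 0 < 1 - radius u ^ N := by linarith
  have : (0 : ℝ) < N := by exact_mod_cast hN
  unfold nodeIntegrand
  positivity

lemma midpointIntegrand_pos (s : ℝ) {N : ℕ} (hN : 1 ≤ N) {u : ℝ} (hu : 0 < u) :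
    0 < midpointIntegrand s N u := by
  obtain ⟨h0, h1, -⟩ := radius_spec hu
  have h2 := weight_pos s hu
  have : (0 : ℝ) < N := by exact_mod_cast hN
  unfold midpointIntegrand
  positivity

lemma nodeIntegrand_le (s : ℝ) {N : ℕ} (hN : 1 ≤ N) {u : ℝ} (hu : 0 < u) :
    nodeIntegrand s N u ≤ nodeIntegrand s 1 u := by
  obtain ⟨h0, h1, -⟩ := radius_spec hu
  unfold nodeIntegrand
  refine mul_le_mul_of_nonneg_left ?_ (weight_pos s hu).le
  simpa using nat_mul_pow_div_le h0 h1 hN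

/-- With R = r^N this is 2R/(1+R) = 2R/(1-R) - 2 · 2R²/(1-R²), the source of the telescoping. -/
lemma midpointIntegrand_eq (s : ℝ) {N : ℕ} (hN : 1 ≤ N) {u : ℝ} (hu : 0 < u) :
    midpointIntegrand s N u = nodeIntegrand s N u - nodeIntegrand s (2 * N) u := by
  obtain ⟨h0, h1, -⟩ := radius_spec hu
  have h3 := pow_lt_one₀ h0.le h1 (by omega : N ≠ 0)
  have h5 : 0 < radius u ^ N := pow_pos h0 N
  unfold midpointIntegrand nodeIntegrand
  rw [← mul_sub, mul_comm 2 N, pow_mul]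
  congr 1
  generalize radius u ^ N = R at *
  have h4 : 1 - R ≠ 0 := by linarith
  have h6 : 1 + R ≠ 0 := by linarith
  have h7 : 1 - R ^ 2 = (1 - R) * (1 + R) := by ring
  push_cast
  rw [h7]
  field_simp
  ring

lemma integrableOn_nodeIntegrand_one {s : ℝ} (hs : s ∈ Set.Ioo 0 1) :
    IntegrableOn (nodeIntegrand s 1) (Set.Ioi 0) := by
  -- At the antipodal pair -1, 1 the Poisson part of the integrand is positive, so the whole
  -- integrand dominates the constant part.
  have h := Real.integrableOn_rpowIntegrand₀₁_Ioi hs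
    (Complex.normSq_nonneg ((-1 : ℂ) - 1))
  refine Integrable.mono' h
    ((continuousOn_nodeIntegrand s le_rfl).aestronglyMeasurable measurableSet_Ioi) ?_
  filter_upwards [ae_restrict_mem measurableSet_Ioi] with u hu
  rw [Real.norm_of_nonneg (nodeIntegrand_pos s le_rfl hu).le,
    rpowIntegrand_eq_weight s hu (by simp) (by simp)]
  obtain ⟨h0, h1, -⟩ := radius_spec hu
  have h2 := weight_pos s hu
  rw [one_sub_poisson_neg h0 (by simp)]
  have : nodeIntegrand s 1 u = weight s u * (2 * radius u / (1 - radius u)) := by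
    simp [nodeIntegrand]
  rw [this]
  have : 0 ≤ weight s u * (2 * radius u / (1 + radius u)) := by positivity
  linarith

lemma integrableOn_nodeIntegrand {s : ℝ} (hs : s ∈ Set.Ioo 0 1) {N : ℕ} (hN : 1 ≤ N) :
    IntegrableOn (nodeIntegrand s N) (Set.Ioi 0) := by
  refine Integrable.mono' (integrableOn_nodeIntegrand_one hs)
    ((continuousOn_nodeIntegrand s hN).aestronglyMeasurable measurableSet_Ioi) ?_
  filter_upwards [ae_restrict_mem measurableSet_Ioi] with u hu
  rw [Real.norm_of_nonneg (nodeIntegrand_pos s hN hu).le]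
  exact nodeIntegrand_le s hN hu

lemma integrableOn_midpointIntegrand {s : ℝ} (hs : s ∈ Set.Ioo 0 1) {N : ℕ} (hN : 1 ≤ N) :
    IntegrableOn (midpointIntegrand s N) (Set.Ioi 0) :=
  ((integrableOn_nodeIntegrand hs hN).sub
    (integrableOn_nodeIntegrand hs (by omega : 1 ≤ 2 * N))).congr_fun
      (fun _ hu => (midpointIntegrand_eq s hN hu).symm) measurableSet_Ioi

/-- The amount by which the potential of `N` equally spaced points falls short of its mean at one
of these points. -/
noncomputable def nodeDeficit (s : ℝ) (N : ℕ) : ℝ :=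
  normConst s * ∫ u in Set.Ioi 0, nodeIntegrand s N u

/-- The amount by which the potential of `N` equally spaced points exceeds its mean halfway between
neighbouring points. -/
noncomputable def midpointExcess (s : ℝ) (N : ℕ) : ℝ :=
  normConst s * ∫ u in Set.Ioi 0, midpointIntegrand s N u

lemma normConst_pos {s : ℝ} (hs : s ∈ Set.Ioo 0 1) : 0 < normConst s :=
  inv_pos.2 (Real.integral_rpowIntegrand₀₁_one_pos hs)

lemma setIntegral_Ioi_pos {f : ℝ → ℝ} (hf : IntegrableOn f (Set.Ioi 0))
    (hpos : ∀ u, 0 < u → 0 < f u) : 0 < ∫ u in Set.Ioi 0, f u := by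
  rw [setIntegral_pos_iff_support_of_nonneg_ae _ hf]
  · have : Function.support f ∩ Set.Ioi 0 = Set.Ioi 0 :=
      Set.inter_eq_right.2 fun u hu => (hpos u hu).ne'
    rw [this]; simp
  · filter_upwards [ae_restrict_mem measurableSet_Ioi] with u hu using (hpos u hu).le

lemma nodeDeficit_pos {s : ℝ} (hs : s ∈ Set.Ioo 0 1) {N : ℕ} (hN : 1 ≤ N) :
    0 < nodeDeficit s N :=
  mul_pos (normConst_pos hs) (setIntegral_Ioi_pos (integrableOn_nodeIntegrand hs hN)
    fun _ hu => nodeIntegrand_pos s hN hu)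

lemma midpointExcess_pos {s : ℝ} (hs : s ∈ Set.Ioo 0 1) {N : ℕ} (hN : 1 ≤ N) :
    0 < midpointExcess s N :=
  mul_pos (normConst_pos hs) (setIntegral_Ioi_pos (integrableOn_midpointIntegrand hs hN)
    fun _ hu => midpointIntegrand_pos s hN hu)

lemma midpointExcess_eq {s : ℝ} (hs : s ∈ Set.Ioo 0 1) {N : ℕ} (hN : 1 ≤ N) :
    midpointExcess s N = nodeDeficit s N - nodeDeficit s (2 * N) := by
  rw [midpointExcess, nodeDeficit, nodeDeficit, ← mul_sub,
    ← integral_sub (integrableOn_nodeIntegrand hs hN)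
      (integrableOn_nodeIntegrand hs (by omega : 1 ≤ 2 * N))]
  congr 1
  exact setIntegral_congr_fun measurableSet_Ioi fun u hu => midpointIntegrand_eq s hN hu

lemma tendsto_nodeDeficit {s : ℝ} (hs : s ∈ Set.Ioo 0 1) :
    Tendsto (fun N : ℕ => nodeDeficit s N) atTop (𝓝 0) := by
  have h : Tendsto (fun N : ℕ => ∫ u in Set.Ioi 0, nodeIntegrand s N u) atTop
      (𝓝 (∫ _u in Set.Ioi (0 : ℝ), (0 : ℝ))) := by
    refine tendsto_integral_filter_of_dominated_convergence (nodeIntegrand s 1) ?_ ?_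
      (integrableOn_nodeIntegrand_one hs) ?_
    · filter_upwards [eventually_ge_atTop 1] with N hN
      exact (continuousOn_nodeIntegrand s hN).aestronglyMeasurable measurableSet_Ioi
    · filter_upwards [eventually_ge_atTop 1] with N hN
      filter_upwards [ae_restrict_mem measurableSet_Ioi] with u hu
      rw [Real.norm_of_nonneg (nodeIntegrand_pos s hN hu).le]
      exact nodeIntegrand_le s hN hu
    · filter_upwards [ae_restrict_mem measurableSet_Ioi] with u hu
      obtain ⟨h0, h1, -⟩ := radius_spec hu
      have t1 := tendsto_self_mul_const_pow_of_lt_one h0.le h1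
      have t2 := tendsto_pow_atTop_nhds_zero_of_lt_one h0.le h1
      have t3 := ((t1.const_mul 2).div (t2.const_sub 1) (by simp)).const_mul (weight s u)
      simp only [mul_zero, zero_div] at t3
      refine t3.congr fun N => ?_
      simp only [nodeIntegrand, Pi.div_apply]
      ring
  simpa [nodeDeficit] using h.const_mul (normConst s)

lemma sum_midpointExcess {s : ℝ} (hs : s ∈ Set.Ioo 0 1) (n : ℕ) :
    ∑ i ∈ Finset.range n, midpointExcess s (2 ^ i) = nodeDeficit s 1 - nodeDeficit s (2 ^ n) := by
  induction n with
  | zero => simp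
  | succ n ih =>
    rw [Finset.sum_range_succ, ih, midpointExcess_eq hs Nat.one_le_two_pow, ← pow_succ']
    ring

/-! ### Potentials of Poisson regular configurations. -/

/-- The first `N` terms of `b` average the Poisson kernels like the vertices of a regular
`N`-gon. -/
def IsPoissonRegular (N : ℕ) (b : ℕ → Circle) : Prop :=
  ∀ r : ℝ, 0 < r → r < 1 → ∀ x : Circle,
    ∑ k ∈ Finset.range N, poisson r x (b k) = N * poisson (r ^ N) ((x : ℂ) ^ N) ((b 0 : ℂ) ^ N)

lemma normSq_pow_circle (x : Circle) (N : ℕ) : Complex.normSq ((x : ℂ) ^ N) = 1 := by simp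

lemma norm_rpow_eq_integral {s : ℝ} (hs : s ∈ Set.Ioo 0 1) (x c : Circle) :
    ‖(x : ℂ) - (c : ℂ)‖ ^ (2 * s) = normConst s * ∫ u in Set.Ioi 0,
      Real.rpowIntegrand₀₁ s u (Complex.normSq ((x : ℂ) - c)) := by
  rw [normConst, ← Real.rpow_eq_const_mul_integral hs (Complex.normSq_nonneg _),
    Complex.normSq_eq_norm_sq, Real.rpow_mul (norm_nonneg _), Real.rpow_two]

/-- The integrand of the deviation of the potential of `N` equally spaced points from its mean. -/
noncomputable def deviationIntegrand (s : ℝ) (N : ℕ) (x c : ℂ) (u : ℝ) : ℝ :=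
  weight s u * (N * (1 - poisson (radius u ^ N) x c))

lemma IsPoissonRegular.sum_rpowIntegrand {N : ℕ} {b : ℕ → Circle} (hb : IsPoissonRegular N b)
    (s : ℝ) (x : Circle) {u : ℝ} (hu : 0 < u) :
    ∑ k ∈ Finset.range N, Real.rpowIntegrand₀₁ s u (Complex.normSq ((x : ℂ) - b k)) =
      N * nodeIntegrand s 1 u + deviationIntegrand s N ((x : ℂ) ^ N) ((b 0 : ℂ) ^ N) u := by
  obtain ⟨h0, h1, -⟩ := radius_spec hu
  rw [Finset.sum_congr rfl fun k _ => rpowIntegrand_eq_weight s hu (c := (b k : ℂ)) (x := x)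
    (by simp) (by simp)]
  rw [Finset.sum_add_distrib, ← Finset.mul_sum, ← Finset.mul_sum, Finset.sum_sub_distrib,
    hb _ h0 h1 x, deviationIntegrand]
  simp [nodeIntegrand]
  ring

lemma IsPoissonRegular.integrableOn_and_potential {s : ℝ} (hs : s ∈ Set.Ioo 0 1) {N : ℕ}
    {b : ℕ → Circle} (hb : IsPoissonRegular N b) (x : Circle) :
    IntegrableOn (deviationIntegrand s N ((x : ℂ) ^ N) ((b 0 : ℂ) ^ N)) (Set.Ioi 0) ∧
    potential (2 * s) b N x = N * nodeDeficit s 1 + normConst s * ∫ u in Set.Ioi 0,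
      deviationIntegrand s N ((x : ℂ) ^ N) ((b 0 : ℂ) ^ N) u := by
  have hi : ∀ k ∈ Finset.range N, IntegrableOn
      (fun u => Real.rpowIntegrand₀₁ s u (Complex.normSq ((x : ℂ) - b k))) (Set.Ioi 0) :=
    fun k _ => Real.integrableOn_rpowIntegrand₀₁_Ioi hs (Complex.normSq_nonneg _)
  have h1 := (integrableOn_nodeIntegrand_one hs).const_mul (N : ℝ)
  have hd : IntegrableOn (deviationIntegrand s N ((x : ℂ) ^ N) ((b 0 : ℂ) ^ N)) (Set.Ioi 0) := by
    refine IntegrableOn.congr_fun ((integrable_finsetSum _ hi).sub h1) (fun u hu => ?_)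
      measurableSet_Ioi
    have := hb.sum_rpowIntegrand s x hu
    simp only [Pi.sub_apply]
    linarith
  refine ⟨hd, ?_⟩
  rw [potential, Finset.sum_congr rfl fun k _ => norm_rpow_eq_integral hs x (b k),
    ← Finset.mul_sum, ← integral_finsetSum _ hi,
    setIntegral_congr_fun measurableSet_Ioi fun u hu => hb.sum_rpowIntegrand s x hu,
    integral_add h1 hd, integral_const_mul, nodeDeficit]
  ring

lemma IsPoissonRegular.potential_le {s : ℝ} (hs : s ∈ Set.Ioo 0 1) {N : ℕ} (hN : 1 ≤ N)
    {b : ℕ → Circle} (hb : IsPoissonRegular N b) (x : Circle) :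
    potential (2 * s) b N x ≤ N * nodeDeficit s 1 + midpointExcess s N := by
  obtain ⟨hi, he⟩ := hb.integrableOn_and_potential hs x
  rw [he, midpointExcess]
  refine add_le_add_right (mul_le_mul_of_nonneg_left (setIntegral_mono_on hi
    (integrableOn_midpointIntegrand hs hN) measurableSet_Ioi fun u hu => ?_)
      (normConst_pos hs).le) _
  obtain ⟨h0, h1, -⟩ := radius_spec hu
  refine mul_le_mul_of_nonneg_left (mul_le_mul_of_nonneg_left ?_ N.cast_nonneg)
    (weight_pos s hu).le
  exact one_sub_poisson_le (pow_pos h0 N) (pow_lt_one₀ h0.le h1 (by omega))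
    (normSq_pow_circle x N) (normSq_pow_circle (b 0) N)

/-- Serves only to identify the energy: with `IsPoissonRegular.potential_le` it traps the potential
in a window that shrinks as N grows. -/
lemma IsPoissonRegular.le_potential {s : ℝ} (hs : s ∈ Set.Ioo 0 1) {N : ℕ} (hN : 1 ≤ N)
    {b : ℕ → Circle} (hb : IsPoissonRegular N b) (x : Circle) :
    N * nodeDeficit s 1 - nodeDeficit s N ≤ potential (2 * s) b N x := by
  obtain ⟨hi, he⟩ := hb.integrableOn_and_potential hs x
  have hd : nodeDeficit s N = normConst s * ∫ u in Set.Ioi 0, nodeIntegrand s N u := rfl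
  rw [he, hd, sub_eq_add_neg, ← mul_neg, ← integral_neg]
  refine add_le_add_right (mul_le_mul_of_nonneg_left (setIntegral_mono_on
    (integrableOn_nodeIntegrand hs hN).neg hi measurableSet_Ioi fun u hu => ?_)
      (normConst_pos hs).le) _
  obtain ⟨h0, h1, -⟩ := radius_spec hu
  rw [Pi.neg_apply, nodeIntegrand, ← mul_neg, ← mul_neg]
  refine mul_le_mul_of_nonneg_left (mul_le_mul_of_nonneg_left ?_ N.cast_nonneg)
    (weight_pos s hu).le
  exact poisson_le (pow_pos h0 N) (pow_lt_one₀ h0.le h1 (by omega))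
    (normSq_pow_circle x N) (normSq_pow_circle (b 0) N)

/-- Away from the midpoints the integrands differ strictly at every u > 0, hence so do the
integrals. This rigidity forces greedy points onto midpoints. -/
lemma IsPoissonRegular.potential_eq_iff {s : ℝ} (hs : s ∈ Set.Ioo 0 1) {N : ℕ} (hN : 1 ≤ N)
    {b : ℕ → Circle} (hb : IsPoissonRegular N b) (x : Circle) :
    potential (2 * s) b N x = N * nodeDeficit s 1 + midpointExcess s N ↔
      (x : ℂ) ^ N = -(b 0 : ℂ) ^ N := by
  obtain ⟨hi, he⟩ := hb.integrableOn_and_potential hs x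
  have hN' : (0 : ℝ) < N := by exact_mod_cast hN
  rw [he, midpointExcess]
  constructor
  · intro h
    by_contra hne
    have hpos := setIntegral_Ioi_pos ((integrableOn_midpointIntegrand hs hN).sub hi)
      fun u hu => by
        obtain ⟨h0, h1, -⟩ := radius_spec hu
        have := mul_lt_mul_of_pos_left (mul_lt_mul_of_pos_left
          (one_sub_poisson_lt (pow_pos h0 N) (pow_lt_one₀ h0.le h1 (by omega))
            (normSq_pow_circle x N) (normSq_pow_circle (b 0) N) hne) hN') (weight_pos s hu)
        simpa [midpointIntegrand, deviationIntegrand] using this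
    simp only [Pi.sub_apply] at hpos
    rw [integral_sub (integrableOn_midpointIntegrand hs hN) hi] at hpos
    have := mul_left_cancel₀ (normConst_pos hs).ne' (add_left_cancel h)
    linarith
  · intro h
    congr 2
    refine setIntegral_congr_fun measurableSet_Ioi fun u hu => ?_
    obtain ⟨h0, h1, -⟩ := radius_spec hu
    simp only [midpointIntegrand, deviationIntegrand]
    rw [h, one_sub_poisson_neg (pow_pos h0 N) (normSq_pow_circle (b 0) N)]

/-! ### Dyadic structure of greedy sequences. -/

/-- The terms `b 1, …, b m` are chosen greedily. -/
def IsGreedyUpTo (lam : ℝ) (b : ℕ → Circle) (m : ℕ) : Prop :=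
  ∀ k, 1 ≤ k → k ≤ m → ∀ x : Circle, potential lam b k x ≤ potential lam b k (b k)

lemma IsGreedyUpTo.mono {lam : ℝ} {b : ℕ → Circle} {m k : ℕ} (h : IsGreedyUpTo lam b m)
    (hk : k ≤ m) : IsGreedyUpTo lam b k := fun i h1 hi => h i h1 (hi.trans hk)

lemma potential_congr (lam : ℝ) {b c : ℕ → Circle} {m : ℕ} (h : ∀ k < m, b k = c k) (x : Circle) :
    potential lam b m x = potential lam c m x :=
  Finset.sum_congr rfl fun k hk => by rw [h k (Finset.mem_range.1 hk)]

lemma potential_add (lam : ℝ) (b : ℕ → Circle) (N j : ℕ) (x : Circle) :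
    potential lam b (N + j) x = potential lam b N x + potential lam (fun k => b (N + k)) j x := by
  simp only [potential, Finset.sum_range_add]

lemma continuous_norm_sub_rpow {lam : ℝ} (hlam : 0 < lam) (y : Circle) :
    Continuous fun x : Circle => ‖(x : ℂ) - (y : ℂ)‖ ^ lam :=
  Continuous.rpow_const (by fun_prop) fun _ => .inr hlam.le

lemma continuous_potential {lam : ℝ} (hlam : 0 < lam) (b : ℕ → Circle) (m : ℕ) :
    Continuous (potential lam b m) := by
  unfold potential
  exact continuous_finsetSum _ fun k _ => continuous_norm_sub_rpow hlam (b k)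

lemma exists_potential_max {lam : ℝ} (hlam : 0 < lam) (b : ℕ → Circle) (m : ℕ) :
    ∃ y, ∀ x, potential lam b m x ≤ potential lam b m y := by
  obtain ⟨y, -, hy⟩ := isCompact_univ.exists_isMaxOn (Set.univ_nonempty (α := Circle))
    (continuous_potential hlam b m).continuousOn
  exact ⟨y, fun x => hy (Set.mem_univ x)⟩

lemma exists_circle_pow_eq_neg (c : Circle) {N : ℕ} (hN : 1 ≤ N) :
    ∃ y : Circle, (y : ℂ) ^ N = -(c : ℂ) ^ N := by
  refine ⟨c * Circle.exp (Real.pi / N), ?_⟩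
  have hN' : (N : ℂ) ≠ 0 := by exact_mod_cast (by omega : N ≠ 0)
  have : (N : ℂ) * (((Real.pi / N : ℝ) : ℂ) * Complex.I) = Real.pi * Complex.I := by
    push_cast; field_simp
  rw [Circle.coe_mul, mul_pow, Circle.coe_exp, ← Complex.exp_nat_mul, this, Complex.exp_pi_mul_I]
  ring

/-- A greedy sequence stays among the `2 ^ n`-th roots of `(b 0) ^ (2 ^ n)` for `2 ^ n` steps. -/
def GreedyStaysInRoots (lam : ℝ) (n : ℕ) : Prop :=
  ∀ (b : ℕ → Circle) (m : ℕ), m < 2 ^ n → IsGreedyUpTo lam b m →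
    (b m : ℂ) ^ 2 ^ n = (b 0 : ℂ) ^ 2 ^ n

/-- The first `2 ^ n` points of a greedy sequence are Poisson regular. -/
def GreedyIsRegular (lam : ℝ) (n : ℕ) : Prop :=
  ∀ b : ℕ → Circle, IsGreedyUpTo lam b (2 ^ n - 1) → IsPoissonRegular (2 ^ n) b

/-- After `2 ^ n` greedy points, the following ones are midpoints which are again chosen greedily
with respect to each other. -/
lemma greedy_shift {s : ℝ} (hs : s ∈ Set.Ioo 0 1) {n : ℕ} (hP : GreedyStaysInRoots (2 * s) n)
    (hQ : GreedyIsRegular (2 * s) n) {b : ℕ → Circle} (j : ℕ) (hj : j < 2 ^ n)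
    (hb : IsGreedyUpTo (2 * s) b (2 ^ n + j)) :
    (b (2 ^ n + j) : ℂ) ^ 2 ^ n = -(b 0 : ℂ) ^ 2 ^ n ∧
      IsGreedyUpTo (2 * s) (fun k => b (2 ^ n + k)) j := by
  have hlam : 0 < 2 * s := mul_pos two_pos hs.1
  have hN : 1 ≤ 2 ^ n := Nat.one_le_two_pow
  have hreg := hQ b (hb.mono (by omega))
  induction j using Nat.strong_induction_on with
  | _ j ih =>
    have hprev : IsGreedyUpTo (2 * s) (fun k => b (2 ^ n + k)) (j - 1) := by
      rcases Nat.eq_zero_or_pos j with rfl | hj0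
      · intro k h1 h2; omega
      · exact (ih (j - 1) (by omega) (by omega) (hb.mono (by omega))).2
    -- The key witness is a midpoint y of the first block that also maximizes the potential of the
    -- later points.
    obtain ⟨y, hy, hmax⟩ : ∃ y : Circle, (y : ℂ) ^ 2 ^ n = -(b 0 : ℂ) ^ 2 ^ n ∧
        ∀ x, potential (2 * s) (fun k => b (2 ^ n + k)) j x ≤
          potential (2 * s) (fun k => b (2 ^ n + k)) j y := by
      rcases Nat.eq_zero_or_pos j with rfl | hj0
      · obtain ⟨y, hy⟩ := exists_circle_pow_eq_neg (b 0) hN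
        exact ⟨y, hy, fun x => by simp [potential]⟩
      · obtain ⟨y, hmax⟩ := exists_potential_max hlam (fun k => b (2 ^ n + k)) j
        refine ⟨y, ?_, hmax⟩
        -- Replacing the j-th later point by the maximizer y keeps the shifted sequence greedy, so
        -- `hP` gives y the same 2^n-th power as the first later point, which is already known to be
        -- a midpoint.
        let c := Function.update (fun k => b (2 ^ n + k)) j y
        have hcj : c j = y := Function.update_self ..
        have hck : ∀ k < j, c k = b (2 ^ n + k) := fun k hk =>
          Function.update_of_ne (by omega) ..
        have hc : IsGreedyUpTo (2 * s) c j := by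
          intro k h1 hk x
          have hpot : ∀ x, potential (2 * s) c k x =
              potential (2 * s) (fun k => b (2 ^ n + k)) k x :=
            potential_congr _ fun i hi => hck i (by omega)
          rw [hpot, hpot]
          rcases hk.lt_or_eq with hlt | rfl
          · rw [hck k hlt]
            exact hprev k h1 (by omega) x
          · rw [hcj]; exact hmax x
        have h1 := hP c j hj hc
        rw [hcj, hck 0 hj0] at h1
        rw [h1]
        exact (ih 0 hj0 (by omega) (hb.mono (by omega))).1
    -- Both blocks' potentials attain their maxima at y, so a maximizer of the sum must maximize
    -- each of them.
    have hle := hreg.potential_le hs hN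
    have hyeq := (hreg.potential_eq_iff hs hN y).2 (by exact_mod_cast hy)
    have hgr := hb (2 ^ n + j) (by omega) le_rfl y
    rw [potential_add, potential_add] at hgr
    have h1 := hle (b (2 ^ n + j))
    have h2 := hmax (b (2 ^ n + j))
    refine ⟨(hreg.potential_eq_iff hs hN _).1 (by linarith), fun k hk1 hk x => ?_⟩
    rcases hk.lt_or_eq with hlt | rfl
    · exact hprev k hk1 (by omega) x
    · exact (hmax x).trans (by linarith)

/-- The two blocks have opposite N-th powers, so `poisson_add_poisson_neg` at radius r^N merges
them. -/
lemma isPoissonRegular_two_mul {N : ℕ} (hN : 1 ≤ N) {b : ℕ → Circle}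
    (h1 : IsPoissonRegular N b) (h2 : IsPoissonRegular N fun k => b (N + k))
    (h : (b N : ℂ) ^ N = -(b 0 : ℂ) ^ N) : IsPoissonRegular (2 * N) b := by
  intro r h0 hr x
  have e2 := h2 r h0 hr x
  simp only [add_zero] at e2
  rw [two_mul, Finset.sum_range_add, h1 r h0 hr x, e2, h, ← mul_add,
    poisson_add_poisson_neg (pow_pos h0 N) (pow_lt_one₀ h0.le hr (by omega))
      (normSq_pow_circle x N) (normSq_pow_circle (b 0) N), ← two_mul, mul_comm 2 N]
  simp only [← pow_mul]
  push_cast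
  ring

/-- The two properties must be proved together, since `greedy_shift` needs both at level n; one more
squaring removes the sign between the blocks. -/
lemma greedy_structure {s : ℝ} (hs : s ∈ Set.Ioo 0 1) (n : ℕ) :
    GreedyStaysInRoots (2 * s) n ∧ GreedyIsRegular (2 * s) n := by
  induction n with
  | zero =>
    refine ⟨fun b m hm _ => ?_, fun b _ r _ _ x => by simp⟩
    obtain rfl : m = 0 := by simpa using hm
    rfl
  | succ n ih =>
    obtain ⟨hP, hQ⟩ := ih
    have hN : 1 ≤ 2 ^ n := Nat.one_le_two_pow
    have h2 : 2 ^ (n + 1) = 2 * 2 ^ n := pow_succ' 2 n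
    constructor
    · intro b m hm hb
      rw [pow_succ, pow_mul, pow_mul]
      rcases lt_or_ge m (2 ^ n) with hlt | hge
      · rw [hP b m hlt hb]
      · obtain ⟨j, rfl⟩ := Nat.exists_eq_add_of_le hge
        rw [(greedy_shift hs hP hQ j (by omega) hb).1, neg_sq]
    · intro b hb
      rw [h2] at hb ⊢
      have hb' : IsGreedyUpTo (2 * s) b (2 ^ n + (2 ^ n - 1)) := hb.mono (by omega)
      exact isPoissonRegular_two_mul hN (hQ b (hb.mono (by omega)))
        (hQ _ (greedy_shift hs hP hQ (2 ^ n - 1) (by omega) hb').2)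
        (greedy_shift hs hP hQ 0 (by omega) (hb.mono (by omega))).1

lemma IsGreedyUpTo.regular {s : ℝ} (hs : s ∈ Set.Ioo 0 1) {n : ℕ} {b : ℕ → Circle}
    (hb : IsGreedyUpTo (2 * s) b (2 ^ n - 1)) : IsPoissonRegular (2 ^ n) b :=
  (greedy_structure hs n).2 b hb

/-! ### The excess through binary digits. -/

/-- The maximal potential minus its mean, with the mean expressed through `nodeDeficit`. -/
noncomputable def excess (s : ℝ) (b : ℕ → Circle) (m : ℕ) : ℝ :=
  potential (2 * s) b m (b m) - m * nodeDeficit s 1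

/-- Strips the leading binary digit of the index. -/
lemma excess_add {s : ℝ} (hs : s ∈ Set.Ioo 0 1) {n j : ℕ} (hj : j < 2 ^ n) {b : ℕ → Circle}
    (hb : IsGreedyUpTo (2 * s) b (2 ^ n + j)) :
    excess s b (2 ^ n + j) = midpointExcess s (2 ^ n) + excess s (fun k => b (2 ^ n + k)) j := by
  have h1 := (greedy_shift hs (greedy_structure hs n).1 (greedy_structure hs n).2 j hj hb).1
  have h2 := ((IsGreedyUpTo.regular hs (hb.mono (by omega))).potential_eq_iff hs
    Nat.one_le_two_pow _).2 h1
  rw [excess, excess, potential_add, h2]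
  push_cast
  ring

/-- The induction on n removes the top digit; the upper bound corresponds to all n digits being 1,
which is m = 2^n - 1. -/
lemma excess_bounds {s : ℝ} (hs : s ∈ Set.Ioo 0 1) (n : ℕ) {m : ℕ} (hm : m < 2 ^ n)
    {b : ℕ → Circle} (hb : IsGreedyUpTo (2 * s) b m) :
    0 ≤ excess s b m ∧ (1 ≤ m → 0 < excess s b m) ∧
      excess s b m ≤ ∑ i ∈ Finset.range n, midpointExcess s (2 ^ i) ∧
      (m = 2 ^ n - 1 → excess s b m = ∑ i ∈ Finset.range n, midpointExcess s (2 ^ i)) := by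
  induction n generalizing m b with
  | zero =>
    obtain rfl : m = 0 := by simpa using hm
    simp [excess, potential]
  | succ n ih =>
    have h2 : 2 ^ (n + 1) = 2 * 2 ^ n := pow_succ' 2 n
    have hpos := midpointExcess_pos hs (Nat.one_le_two_pow (n := n))
    rw [Finset.sum_range_succ]
    rcases lt_or_ge m (2 ^ n) with hlt | hge
    · obtain ⟨i1, i2, i3, -⟩ := ih hlt hb
      have : 1 ≤ 2 ^ n := Nat.one_le_two_pow
      exact ⟨i1, i2, by linarith, fun h => by omega⟩
    · obtain ⟨j, rfl⟩ := Nat.exists_eq_add_of_le hge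
      have hj : j < 2 ^ n := by omega
      obtain ⟨i1, -, i3, i4⟩ := ih hj
        (greedy_shift hs (greedy_structure hs n).1 (greedy_structure hs n).2 j hj hb).2
      rw [excess_add hs hj hb]
      refine ⟨by linarith, fun _ => by linarith, by linarith, fun h => ?_⟩
      rw [i4 (by omega)]
      ring

lemma excess_two_pow {s : ℝ} (hs : s ∈ Set.Ioo 0 1) (n : ℕ) {b : ℕ → Circle}
    (hb : IsGreedyUpTo (2 * s) b (2 ^ n)) : excess s b (2 ^ n) = midpointExcess s (2 ^ n) := by
  have := excess_add hs (j := 0) (by positivity) hb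
  simpa [excess, potential] using this

/-! ### The uniform measure and its energy. -/

instance isProbabilityMeasure_sigmaOne : IsProbabilityMeasure sigmaOne := by
  constructor
  have h : 0 < ENNReal.ofReal (2 * Real.pi) := ENNReal.ofReal_pos.2 Real.two_pi_pos
  rw [sigmaOne, Measure.map_apply Circle.exp.continuous.measurable MeasurableSet.univ]
  simp only [Set.preimage_univ, Measure.smul_apply, Measure.restrict_apply_univ, Real.volume_Ioc,
    sub_zero, smul_eq_mul]
  exact ENNReal.inv_mul_cancel h.ne' ENNReal.ofReal_ne_top

lemma integral_sigmaOne {f : Circle → ℝ} (hf : Continuous f) :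
    ∫ x, f x ∂sigmaOne = (2 * Real.pi)⁻¹ * ∫ t in 0..2 * Real.pi, f (Circle.exp t) := by
  have h : 0 < 2 * Real.pi := Real.two_pi_pos
  rw [sigmaOne, integral_map Circle.exp.continuous.aemeasurable hf.aestronglyMeasurable,
    integral_smul_measure, intervalIntegral.integral_of_le h.le, ENNReal.toReal_inv,
    ENNReal.toReal_ofReal h.le, smul_eq_mul]

lemma integral_sigmaOne_mul_right {f : Circle → ℝ} (hf : Continuous f) (y : Circle) :
    ∫ x, f (x * y) ∂sigmaOne = ∫ x, f x ∂sigmaOne := by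
  rw [integral_sigmaOne hf, integral_sigmaOne (f := fun x => f (x * y)) (by fun_prop)]
  congr 1
  obtain ⟨a, rfl⟩ : ∃ a, Circle.exp a = y := ⟨_, Circle.exp_arg y⟩
  have hp : Function.Periodic (fun t => f (Circle.exp t)) (2 * Real.pi) := fun t => by
    simp [Circle.exp_add, Circle.exp_two_pi]
  have := hp.intervalIntegral_add_eq a 0
  rw [zero_add] at this
  simp only [← Circle.exp_add]
  rw [intervalIntegral.integral_comp_add_right (fun t => f (Circle.exp t)), zero_add,
    add_comm _ a, this]

lemma integral_norm_sub_rpow {lam : ℝ} (hlam : 0 < lam) (y : Circle) :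
    ∫ x : Circle, ‖(x : ℂ) - (y : ℂ)‖ ^ lam ∂sigmaOne =
      ∫ x : Circle, ‖(x : ℂ) - ((1 : Circle) : ℂ)‖ ^ lam ∂sigmaOne := by
  rw [← integral_sigmaOne_mul_right (continuous_norm_sub_rpow hlam y) y]
  refine integral_congr_ae (.of_forall fun x => ?_)
  have : ((x * y : Circle) : ℂ) - y = ((x : ℂ) - ((1 : Circle) : ℂ)) * y := by
    rw [Circle.coe_mul, Circle.coe_one]; ring
  simp only [this, norm_mul, Circle.norm_coe, mul_one]

lemma integral_norm_sub_rpow_eq_energy {lam : ℝ} (hlam : 0 < lam) (y : Circle) :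
    ∫ x : Circle, ‖(x : ℂ) - (y : ℂ)‖ ^ lam ∂sigmaOne = energy lam sigmaOne := by
  simp only [energy, integral_norm_sub_rpow hlam, integral_const, probReal_univ, one_smul]

lemma integrable_sigmaOne {f : Circle → ℝ} (hf : Continuous f) : Integrable f sigmaOne := by
  rw [← integrableOn_univ]
  exact hf.continuousOn.integrableOn_compact isCompact_univ

lemma integral_potential {lam : ℝ} (hlam : 0 < lam) (b : ℕ → Circle) (N : ℕ) :
    ∫ x, potential lam b N x ∂sigmaOne = N * energy lam sigmaOne := by
  simp only [potential]
  rw [integral_finsetSum _ fun k _ => integrable_sigmaOne (continuous_norm_sub_rpow hlam (b k))]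
  simp [integral_norm_sub_rpow_eq_energy hlam]

/-- Integrating the two-sided bound on the potential of 2^n regular points leaves an error at most
`nodeDeficit s (2 ^ n)`, which vanishes in the limit. The greedy sequence only supplies regular
configurations of these sizes. -/
lemma energy_eq_nodeDeficit {s : ℝ} (hs : s ∈ Set.Ioo 0 1) {b : ℕ → Circle}
    (hb : IsGreedy (2 * s) b) : energy (2 * s) sigmaOne = nodeDeficit s 1 := by
  have hlam : 0 < 2 * s := mul_pos two_pos hs.1
  have hbound : ∀ n : ℕ, (2 : ℝ) ^ n * |energy (2 * s) sigmaOne - nodeDeficit s 1| ≤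
      nodeDeficit s (2 ^ n) := by
    intro n
    have hN : 1 ≤ 2 ^ n := Nat.one_le_two_pow
    have hreg : IsPoissonRegular (2 ^ n) b := IsGreedyUpTo.regular hs fun k hk _ => hb k hk
    have hint := integrable_sigmaOne (continuous_potential hlam b (2 ^ n))
    have h1 := integral_mono hint (integrable_const _) (hreg.potential_le hs hN)
    have h2 := integral_mono (integrable_const _) hint (hreg.le_potential hs hN)
    simp only [integral_const, probReal_univ, one_smul, integral_potential hlam] at h1 h2
    have h3 := midpointExcess_eq hs hN
    have h4 := nodeDeficit_pos hs (by omega : 1 ≤ 2 * 2 ^ n)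
    push_cast at h1 h2
    rw [← abs_of_pos (by positivity : (0 : ℝ) < 2 ^ n), ← abs_mul, abs_le]
    constructor <;> linarith
  have ht := (tendsto_nodeDeficit hs).comp (tendsto_pow_atTop_atTop_of_one_lt one_lt_two)
  have h0 : |energy (2 * s) sigmaOne - nodeDeficit s 1| ≤ 0 :=
    ge_of_tendsto' ht fun n => le_trans (le_mul_of_one_le_left (abs_nonneg _)
      (one_le_pow₀ one_le_two)) (hbound n)
  exact sub_eq_zero.1 (abs_nonpos_iff.1 h0)

/-! ### Sharpness along subsequences and the main theorem. -/

lemma liminf_eq_of_tendsto_comp {f : ℕ → ℝ} {φ : ℕ → ℕ} {l B : ℝ} (hl : ∀ n, l ≤ f n)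
    (hB : ∀ n, f n ≤ B) (hφ : Tendsto φ atTop atTop) (h : Tendsto (f ∘ φ) atTop (𝓝 l)) :
    liminf f atTop = l := by
  have hb : IsBoundedUnder (· ≥ ·) atTop f := isBoundedUnder_of ⟨l, hl⟩
  refine le_antisymm (le_of_forall_pos_le_add fun ε hε => ?_)
    (le_liminf_of_le (isBoundedUnder_of ⟨B, hB⟩).isCoboundedUnder_ge (.of_forall hl))
  refine liminf_le_of_frequently_le ?_ hb
  refine hφ.frequently (Eventually.frequently ?_)
  filter_upwards [h.eventually_le_const (lt_add_of_pos_right l hε)] with n hn using hn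

lemma limsup_eq_of_tendsto_comp {f : ℕ → ℝ} {φ : ℕ → ℕ} {l B : ℝ} (hl : ∀ n, f n ≤ l)
    (hB : ∀ n, B ≤ f n) (hφ : Tendsto φ atTop atTop) (h : Tendsto (f ∘ φ) atTop (𝓝 l)) :
    limsup f atTop = l := by
  have hb : IsBoundedUnder (· ≤ ·) atTop f := isBoundedUnder_of ⟨l, hl⟩
  refine le_antisymm
    (limsup_le_of_le (isBoundedUnder_of ⟨B, hB⟩).isCoboundedUnder_le (.of_forall hl))
    (le_of_forall_sub_le fun ε hε => ?_)
  refine le_limsup_of_frequently_le ?_ hb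
  refine hφ.frequently (Eventually.frequently ?_)
  filter_upwards [h.eventually_const_le (sub_lt_self l hε)] with n hn using hn

end GreedyCircle

theorem theorem3p10 (lam : ℝ) (hlam0 : 0 < lam) (hlam2 : lam < 2)
    (a : ℕ → Circle) (ha : GreedyCircle.IsGreedy lam a) :
    -- the sequence is bounded
    (∃ C : ℝ, ∀ N : ℕ, 1 ≤ N → |GreedyCircle.secondOrder lam a N| ≤ C) ∧
    -- and divergent
    (¬ ∃ l : ℝ, Tendsto (fun N : ℕ => GreedyCircle.secondOrder lam a N) atTop (𝓝 l)) ∧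
    -- strict two-sided bounds
    (∀ N : ℕ, 1 ≤ N → 0 < GreedyCircle.secondOrder lam a N ∧
      GreedyCircle.secondOrder lam a N < GreedyCircle.energy lam GreedyCircle.sigmaOne) ∧
    -- which are sharp
    liminf (fun N : ℕ => GreedyCircle.secondOrder lam a N) atTop = 0 ∧
    limsup (fun N : ℕ => GreedyCircle.secondOrder lam a N) atTop =
      GreedyCircle.energy lam GreedyCircle.sigmaOne ∧
    -- with the liminf and limsup attained along `2 ^ n` and `2 ^ n - 1` respectively
    Tendsto (fun n : ℕ => GreedyCircle.secondOrder lam a (2 ^ n)) atTop (𝓝 0) ∧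
    Tendsto (fun n : ℕ => GreedyCircle.secondOrder lam a (2 ^ n - 1)) atTop
      (𝓝 (GreedyCircle.energy lam GreedyCircle.sigmaOne)) := by
  open GreedyCircle in
  obtain ⟨s, rfl⟩ : ∃ s, lam = 2 * s := ⟨lam / 2, by ring⟩
  have hs : s ∈ Set.Ioo 0 1 := ⟨by linarith, by linarith⟩
  have hI : energy (2 * s) sigmaOne = nodeDeficit s 1 := energy_eq_nodeDeficit hs ha
  have hup : ∀ m, IsGreedyUpTo (2 * s) a m := fun m k hk _ => ha k hk
  have hex : ∀ N, secondOrder (2 * s) a N = excess s a N := fun N => by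
    rw [secondOrder, excess, hI]
  -- Any dyadic level above N would do; N < 2^N gives one without logarithms.
  have hb := fun N : ℕ => excess_bounds hs N (N.lt_two_pow_self) (hup N)
  have hpos : 0 < nodeDeficit s 1 := nodeDeficit_pos hs le_rfl
  have hlt : ∀ N, excess s a N < nodeDeficit s 1 := fun N => by
    have h1 := (hb N).2.2.1
    rw [sum_midpointExcess hs] at h1
    have := nodeDeficit_pos hs (Nat.one_le_two_pow (n := N))
    linarith
  have hpow : Tendsto (fun n : ℕ => 2 ^ n) atTop atTop :=
    tendsto_pow_atTop_atTop_of_one_lt one_lt_two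
  have hpow' : Tendsto (fun n : ℕ => 2 ^ n - 1) atTop atTop := (tendsto_sub_atTop_nat 1).comp hpow
  have ht := (tendsto_nodeDeficit hs).comp hpow
  have hlow : Tendsto (fun n : ℕ => excess s a (2 ^ n)) atTop (𝓝 0) := by
    have h := ht.sub (ht.comp (tendsto_add_atTop_nat 1))
    rw [sub_zero] at h
    refine h.congr fun n => ?_
    rw [excess_two_pow hs n (hup _), midpointExcess_eq hs Nat.one_le_two_pow, ← pow_succ']
    rfl
  have hhigh : Tendsto (fun n : ℕ => excess s a (2 ^ n - 1)) atTop (𝓝 (nodeDeficit s 1)) := by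
    have h := ht.const_sub (nodeDeficit s 1)
    rw [sub_zero] at h
    refine h.congr fun n => ?_
    have := Nat.one_le_two_pow (n := n)
    rw [(excess_bounds hs n (by omega) (hup _)).2.2.2 rfl, sum_midpointExcess hs]
    rfl
  simp only [hex, hI]
  refine ⟨⟨nodeDeficit s 1, fun N _ => abs_le.2 ⟨by linarith [(hb N).1], (hlt N).le⟩⟩, ?_,
    fun N hN => ⟨(hb N).2.1 hN, hlt N⟩,
    liminf_eq_of_tendsto_comp (fun N => (hb N).1) (fun N => (hlt N).le) hpow hlow,
    limsup_eq_of_tendsto_comp (fun N => (hlt N).le) (fun N => (hb N).1) hpow' hhigh, hlow, hhigh⟩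
  -- A limit would equal both subsequential limits, 0 and the positive number `nodeDeficit s 1`.
  rintro ⟨l, hl⟩
  have h1 := tendsto_nhds_unique (hl.comp hpow) hlow
  have h2 := tendsto_nhds_unique (hl.comp hpow') hhigh
  linarith
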